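/- Let $p$ be a prime number. For an $\mathbf{F}_p$-algebra $R$ (all rings are commutative with $1$), let $F_*R$ denote the ring $R$ regarded as an $R$-algebra via the absolute Frobenius $r \mapsto r^p$. For an ideal $I$ of a ring $A$ and $m \geq 0$, let $I^{[m]}$ be the ideal generated by $\{f^m : f \in I\}$; $I$ is \emph{bounded nil} if $I^{[m]} = 0$ for some $m \geq 0$. A ring map $R \to S$ is \emph{b-nil formally smooth} if for every $R$-algebra $A$ and every bounded nil ideal $I$ of $A$, every $R$-algebra map $S \to A/I$ lifts to an $R$-algebra map $S \to A$. An $R$-module $M$ is \emph{Ohm--Rush trace} if for every $x \in M$ one has $x \in \operatorname{Tr}(x) M$, where $\operatorname{Tr}(x) = \{\varphi(x) : \varphi \in \operatorname{Hom}_R(M,R)\}$. It is \emph{intersection flat} if it is flat and, for every finitely generated $R$-module $L$ and every family $\{U_i\}_i$ of submodules of $L$, one has $(\bigcap_i U_i) \otimes_R M = \bigcap_i (U_i \otimes_R M)$ as submodules of $L \otimes_R M$. An $\mathbf{F}_p$-algebra $R$ is \emph{Frobenius Ohm--Rush trace} (resp. \emph{$F$-intersection flat}) if $F_*R$ is an Ohm--Rush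 trace (resp. intersection flat) $R$-module. Let $R \to S$ be a b-nil formally smooth map of $\mathbf{F}_p$-algebras. Then: \begin{enumerate} \item If $R$ is Frobenius Ohm--Rush trace, then $S$ is Frobenius Ohm--Rush trace. \item If $R$ is $F$-intersection flat, then $S$ is $F$-intersection flat. \item If $F_*R$ is a projective $R$-module, then $S$ is Frobenius Ohm--Rush trace and, in fact, $F_*S$ is a projective $S$-module. \end{enumerate} -/

import Mathlib

open scoped TensorProduct

universe u v

namespace BNil

/-! ### Bounded nil ideals and b-nil formally smooth algebras -/

/-- `I^{[m]}`: the ideal generated by the `m`-th powers of the elements of `I`. -/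
def bracketPower {A : Type u} [CommRing A] (I : Ideal A) (m : ℕ) : Ideal A :=
  Ideal.span {x : A | ∃ f ∈ I, x = f ^ m}

/-- An ideal is *bounded nil* if `I^{[m]} = 0` for some `m ≥ 0`. -/
def IsBoundedNil {A : Type u} [CommRing A] (I : Ideal A) : Prop :=
  ∃ m : ℕ, bracketPower I m = ⊥

/-- `R → S` is *b-nil formally smooth*: for every `R`-algebra `A` and every bounded nil ideal `I`
of `A`, every `R`-algebra map `S → A/I` lifts to an `R`-algebra map `S → A`.

It is enough to test on rings `A` in the universe `max u v`, since it contains the quotients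
of a polynomial ring over `R` mapping onto `S`, from which all other lifts are obtained. -/
def BNilFormallySmooth (R : Type u) (S : Type v) [CommRing R] [CommRing S] [Algebra R S] : Prop :=
  ∀ (A : Type (max u v)) [CommRing A] [Algebra R A] (I : Ideal A), IsBoundedNil I →
    ∀ g : S →ₐ[R] A ⧸ I, ∃ f : S →ₐ[R] A, (Ideal.Quotient.mkₐ R I).comp f = g

/-! ### Ohm-Rush trace modules and intersection flat modules -/

/-- The trace ideal of `x ∈ M`: the ideal `{φ x | φ ∈ Hom_R(M, R)}` of `R`. -/
def traceIdeal (R : Type u) {M : Type v} [CommRing R] [AddCommGroup M] [Module R M] (x : M) :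
    Ideal R :=
  LinearMap.range (Module.Dual.eval R M x)

/-- `M` is an *Ohm-Rush trace* `R`-module if `x ∈ Tr(x) M` for every `x ∈ M`. -/
def IsOhmRushTrace (R : Type u) (M : Type v) [CommRing R] [AddCommGroup M] [Module R M] : Prop :=
  ∀ x : M, x ∈ traceIdeal R x • (⊤ : Submodule R M)

/-- For a submodule `U` of `L`, the image of `U ⊗ M → L ⊗ M`. -/
def tensorImage {R : Type u} {L : Type u} [CommRing R] [AddCommGroup L] [Module R L]
    (U : Submodule R L) (M : Type v) [AddCommGroup M] [Module R M] : Submodule R (L ⊗[R] M) :=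
  LinearMap.range (U.subtype.rTensor M)

/-- `M` is an *intersection flat* `R`-module if it is flat and, for every finitely generated
`R`-module `L`, tensoring with `M` commutes with intersections of arbitrary families of
submodules of `L`. -/
def IsIntersectionFlat (R : Type u) (M : Type v) [CommRing R] [AddCommGroup M] [Module R M] :
    Prop :=
  Module.Flat R M ∧
    ∀ (L : Type u) [AddCommGroup L] [Module R L], Module.Finite R L →
      ∀ 𝒰 : Set (Submodule R L), tensorImage (sInf 𝒰) M = ⨅ U ∈ 𝒰, tensorImage U M

/-! ### The absolute Frobenius -/

theorem add_pow_prime {p : ℕ} [hp : Fact p.Prime] {R : Type u} [CommRing R] [Algebra (ZMod p) R]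
    (x y : R) : (x + y) ^ p = x ^ p + y ^ p := by
  obtain ⟨r, hr⟩ := exists_add_pow_prime_eq hp.out x y
  have h : (p : R) = 0 := by
    rw [← map_natCast (algebraMap (ZMod p) R) p, ZMod.natCast_self, map_zero]
  rw [hr, h]
  ring

/-- The absolute Frobenius `x ↦ x ^ p` of an `𝔽_p`-algebra (the zero ring is allowed). -/
def absFrobenius (p : ℕ) [hp : Fact p.Prime] (R : Type u) [CommRing R] [Algebra (ZMod p) R] :
    R →+* R where
  toFun x := x ^ p
  map_one' := one_pow p
  map_mul' x y := mul_pow x y p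
  map_zero' := zero_pow hp.out.ne_zero
  map_add' := add_pow_prime

/-- `F_* R`: the ring `R`, regarded as an `R`-algebra through the absolute Frobenius. -/
def FrobPush (_p : ℕ) (R : Type u) : Type u := R

instance (p : ℕ) (R : Type u) [CommRing R] : CommRing (FrobPush p R) :=
  inferInstanceAs (CommRing R)

/-- The `R`-module structure of `F_* R` is `r • x = r ^ p * x`. -/
instance (p : ℕ) [Fact p.Prime] (R : Type u) [CommRing R] [Algebra (ZMod p) R] :
    Algebra R (FrobPush p R) :=
  RingHom.toAlgebra (S := FrobPush p R) (absFrobenius p R)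

/-- `R` is *Frobenius Ohm-Rush trace* if `F_* R` is an Ohm-Rush trace `R`-module. -/
def IsFrobeniusOhmRushTrace (p : ℕ) [Fact p.Prime] (R : Type u) [CommRing R]
    [Algebra (ZMod p) R] : Prop :=
  IsOhmRushTrace R (FrobPush p R)

/-- `R` is *`F`-intersection flat* if `F_* R` is an intersection flat `R`-module. -/
def IsFIntersectionFlat (p : ℕ) [Fact p.Prime] (R : Type u) [CommRing R]
    [Algebra (ZMod p) R] : Prop :=
  IsIntersectionFlat R (FrobPush p R)

end BNil

/-! All three assertions follow from one fact: `F_* S` is an `S`-linear retract of a direct sum of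
copies of `S ⊗[R] F_* R`. Let `P = R[S]` be the polynomial ring on the set `S` and `J` the kernel of
`P → S`. Since `J / J^{[p]}` is bounded nil, the identity of `S` lifts to a section `S → P /
J^{[p]}`. Monomials with exponents below `p` form a basis of `F_* P` over `P ⊗[R] F_* R`, and base
change along `P → S` turns `F_* P` into `P / J^{[p]}`, with `s` acting by the `p`-th power of any
lift; so this is a direct sum of copies of `S ⊗[R] F_* R`. The section is linear for this action
(`BNilFormallySmooth.exists_frobPush_retract`). The Ohm-Rush trace property, preservation of
intersections, flatness and projectivity all pass to base changes, direct sums and retracts. -/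

namespace BNil

/-! ### Ohm-Rush trace modules: retracts, direct sums, base change -/

section OhmRush

variable {R : Type*} [CommRing R] {M : Type*} [AddCommGroup M] [Module R M]

variable (R M) in
/-- The endomorphisms of `M` of the form `x ↦ ∑ φ j x • y j`. -/
def finiteRankEnd : Submodule R (M →ₗ[R] M) :=
  Submodule.span R {f | ∃ (φ : M →ₗ[R] R) (y : M), f = φ.smulRight y}

theorem finiteRankEnd_comp {f : M →ₗ[R] M} (hf : f ∈ finiteRankEnd R M) (g : M →ₗ[R] M) :
    f ∘ₗ g ∈ finiteRankEnd R M := by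
  induction hf using Submodule.span_induction with
  | mem f hf =>
    obtain ⟨φ, y, rfl⟩ := hf
    exact Submodule.subset_span ⟨φ ∘ₗ g, y, rfl⟩
  | zero => rw [LinearMap.zero_comp]; exact zero_mem _
  | add a b _ _ ha hb => rw [LinearMap.add_comp]; exact add_mem ha hb
  | smul r a _ ha => rw [LinearMap.smul_comp]; exact Submodule.smul_mem _ _ ha

theorem dual_apply_mem_traceIdeal (φ : M →ₗ[R] R) (x : M) : φ x ∈ traceIdeal R x :=
  ⟨φ, rfl⟩

theorem apply_mem_traceIdeal_smul {f : M →ₗ[R] M} (hf : f ∈ finiteRankEnd R M) (x : M) :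
    f x ∈ traceIdeal R x • (⊤ : Submodule R M) := by
  induction hf using Submodule.span_induction with
  | mem f hf =>
    obtain ⟨φ, y, rfl⟩ := hf
    exact Submodule.smul_mem_smul (dual_apply_mem_traceIdeal φ x) trivial
  | zero => exact zero_mem _
  | add a b _ _ ha hb => exact add_mem ha hb
  | smul r a _ ha => exact Submodule.smul_mem _ _ ha

theorem exists_finiteRankEnd_of_mem {x z : M}
    (hz : z ∈ traceIdeal R x • (⊤ : Submodule R M)) : ∃ f ∈ finiteRankEnd R M, f x = z := by
  induction hz using Submodule.smul_induction_on' with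
  | smul r hr y _ =>
    obtain ⟨φ, rfl⟩ := hr
    exact ⟨φ.smulRight y, Submodule.subset_span ⟨φ, y, rfl⟩, rfl⟩
  | add a _ b _ ha hb =>
    obtain ⟨f, hf, rfl⟩ := ha
    obtain ⟨g, hg, rfl⟩ := hb
    exact ⟨f + g, add_mem hf hg, rfl⟩

theorem isOhmRushTrace_iff_exists_finiteRankEnd :
    IsOhmRushTrace R M ↔ ∀ x : M, ∃ f ∈ finiteRankEnd R M, f x = x := by
  refine ⟨fun h x ↦ exists_finiteRankEnd_of_mem (h x), fun h x ↦ ?_⟩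
  obtain ⟨f, hf, hx⟩ := h x
  have := apply_mem_traceIdeal_smul hf x
  rwa [hx] at this

/-- Over an Ohm-Rush trace module, finitely many elements are fixed by a common endomorphism of
finite rank. -/
theorem IsOhmRushTrace.exists_finiteRankEnd (h : IsOhmRushTrace R M) (s : Finset M) :
    ∃ f ∈ finiteRankEnd R M, ∀ x ∈ s, f x = x := by
  classical
  rw [isOhmRushTrace_iff_exists_finiteRankEnd] at h
  induction s using Finset.induction_on with
  | empty => exact ⟨0, zero_mem _, by simp⟩
  | insert a s _ ih =>
    obtain ⟨f, hf, hfs⟩ := ih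
    obtain ⟨g, hg, hga⟩ := h (a - f a)
    -- Here `1 - (f + g - g f) = (1 - g)(1 - f)`: the factor `1 - f` kills `s`, and `1 - g` kills `a
    -- - f a`.
    refine ⟨f + g - g ∘ₗ f, sub_mem (add_mem hf hg) (finiteRankEnd_comp hg f), fun x hx ↦ ?_⟩
    simp only [LinearMap.sub_apply, LinearMap.add_apply, LinearMap.comp_apply]
    rcases Finset.mem_insert.mp hx with rfl | hx
    · rw [map_sub] at hga
      rw [add_sub_assoc, hga]
      abel
    · rw [hfs x hx]
      abel

theorem IsOhmRushTrace.of_retract {N : Type*} [AddCommGroup N] [Module R N]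
    (h : IsOhmRushTrace R M) (i : N →ₗ[R] M) (r : M →ₗ[R] N) (hri : ∀ x, r (i x) = x) :
    IsOhmRushTrace R N := by
  intro x
  have hle : traceIdeal R (i x) ≤ traceIdeal R x := by
    rintro _ ⟨φ, rfl⟩
    exact dual_apply_mem_traceIdeal (φ ∘ₗ i) x
  have := Submodule.mem_map_of_mem (f := r) (h (i x))
  rw [hri, Submodule.map_smul''] at this
  exact Submodule.smul_mono hle le_top this

theorem isOhmRushTrace_self : IsOhmRushTrace R R := fun x ↦ by
  have := Submodule.smul_mem_smul (N := (⊤ : Submodule R R))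
    (dual_apply_mem_traceIdeal LinearMap.id x) (Submodule.mem_top (x := (1 : R)))
  simpa using this

theorem IsOhmRushTrace.finsupp (h : IsOhmRushTrace R M) (ι : Type*) :
    IsOhmRushTrace R (ι →₀ M) := by
  intro x
  have hx : x = ∑ i ∈ x.support, Finsupp.lsingle (R := R) i (x i) := (Finsupp.sum_single x).symm
  have key (i : ι) : Finsupp.lsingle (R := R) i (x i) ∈
      traceIdeal R x • (⊤ : Submodule R (ι →₀ M)) := by
    have hle : traceIdeal R (x i) ≤ traceIdeal R x := by
      rintro _ ⟨φ, rfl⟩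
      exact dual_apply_mem_traceIdeal (φ ∘ₗ Finsupp.lapply i) x
    have := Submodule.mem_map_of_mem (f := Finsupp.lsingle (R := R) i) (h (x i))
    rw [Submodule.map_smul''] at this
    exact Submodule.smul_mono hle le_top this
  have := sum_mem (t := x.support) fun i _ ↦ key i
  rwa [← hx] at this

/-- An element of `S ⊗[R] M` involves only finitely many elements of `M`. A finite-rank endomorphism
fixing all of these has a base change that is again of finite rank and fixes the given tensor. -/
theorem IsOhmRushTrace.baseChange (h : IsOhmRushTrace R M) (S : Type*) [CommRing S]
    [Algebra R S] : IsOhmRushTrace S (S ⊗[R] M) := by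
  classical
  have hmem {f : M →ₗ[R] M} (hf : f ∈ finiteRankEnd R M) :
      f.baseChange S ∈ finiteRankEnd S (S ⊗[R] M) := by
    induction hf using Submodule.span_induction with
    | mem f hf =>
      obtain ⟨φ, y, rfl⟩ := hf
      refine Submodule.subset_span
        ⟨(TensorProduct.AlgebraTensorModule.rid R S S).toLinearMap ∘ₗ φ.baseChange S,
          1 ⊗ₜ y, ?_⟩
      ext m
      simp [TensorProduct.smul_tmul']
    | zero => rw [LinearMap.baseChange_zero]; exact zero_mem _
    | add a b _ _ ha hb => rw [LinearMap.baseChange_add]; exact add_mem ha hb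
    | smul r a _ ha =>
      rw [LinearMap.baseChange_smul, ← algebraMap_smul S]
      exact Submodule.smul_mem _ _ ha
  have hfix (z : S ⊗[R] M) : ∃ s : Finset M, ∀ f : M →ₗ[R] M, (∀ x ∈ s, f x = x) →
      f.baseChange S z = z := by
    induction z using TensorProduct.induction_on with
    | zero => exact ⟨∅, fun f _ ↦ map_zero _⟩
    | tmul a m => exact ⟨{m}, fun f hf ↦ by simp [hf m]⟩
    | add a b ha hb =>
      obtain ⟨s, hs⟩ := ha
      obtain ⟨t, ht⟩ := hb
      refine ⟨s ∪ t, fun f hf ↦ ?_⟩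
      rw [map_add, hs f fun x hx ↦ hf x (Finset.mem_union_left _ hx),
        ht f fun x hx ↦ hf x (Finset.mem_union_right _ hx)]
  rw [isOhmRushTrace_iff_exists_finiteRankEnd]
  intro z
  obtain ⟨s, hs⟩ := hfix z
  obtain ⟨f, hf, hfs⟩ := h.exists_finiteRankEnd s
  exact ⟨_, hmem hf, hs f hfs⟩

theorem isOhmRushTrace_of_projective [Module.Projective R M] : IsOhmRushTrace R M := by
  obtain ⟨s, hs⟩ := Module.Projective.out (R := R) (P := M)
  exact (isOhmRushTrace_self.finsupp M).of_retract s (Finsupp.linearCombination R id) hs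

end OhmRush

/-! ### Intersection flat modules: retracts, direct sums, base change -/

section IntersectionFlat

theorem rTensor_mkQ_eq_zero_of_le_comap {R L L' : Type*} [CommRing R] [AddCommGroup L]
    [Module R L] [AddCommGroup L'] [Module R L'] {M : Type*} [AddCommGroup M] [Module R M]
    {U : Submodule R L} {U' : Submodule R L'} (f : L →ₗ[R] L') (hf : U ≤ U'.comap f)
    {y : L ⊗[R] M} (hy : U.mkQ.rTensor M y = 0) : U'.mkQ.rTensor M (f.rTensor M y) = 0 := by
  rw [← LinearMap.comp_apply, ← LinearMap.rTensor_comp, ← Submodule.mapQ_mkQ (h := hf),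
    LinearMap.rTensor_comp, LinearMap.comp_apply, hy, map_zero]

/-- The map `L / f⁻¹ U → L' / U` is injective, and flatness keeps it so after tensoring with `M`. -/
theorem rTensor_mkQ_comap_eq_zero_iff {R L L' : Type*} [CommRing R] [AddCommGroup L]
    [Module R L] [AddCommGroup L'] [Module R L'] {M : Type*} [AddCommGroup M] [Module R M]
    [Module.Flat R M] (U : Submodule R L') (f : L →ₗ[R] L') (y : L ⊗[R] M) :
    (U.comap f).mkQ.rTensor M y = 0 ↔ U.mkQ.rTensor M (f.rTensor M y) = 0 := by
  refine ⟨rTensor_mkQ_eq_zero_of_le_comap f le_rfl, fun h ↦ ?_⟩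
  have hinj : Function.Injective ((U.comap f).mapQ U f le_rfl) := by
    rw [← LinearMap.ker_eq_bot, Submodule.ker_mapQ, Submodule.mkQ_map_self]
  refine Module.Flat.rTensor_preserves_injective_linearMap _ hinj ?_
  rw [map_zero, ← LinearMap.comp_apply, ← LinearMap.rTensor_comp, Submodule.mapQ_mkQ,
    LinearMap.rTensor_comp, LinearMap.comp_apply, h]

theorem mem_tensorImage_iff {R : Type u} {L : Type u} [CommRing R] [AddCommGroup L] [Module R L]
    {M : Type v} [AddCommGroup M] [Module R M] (U : Submodule R L) (y : L ⊗[R] M) :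
    y ∈ tensorImage U M ↔ U.mkQ.rTensor M y = 0 :=
  (rTensor_exact M (LinearMap.exact_subtype_mkQ U) U.mkQ_surjective y).symm

/-- Tensoring with `M` commutes with intersections of submodules of arbitrary modules in the
universe `w`, expressed through vanishing in the quotients. -/
def TensorPreservesInter.{w, u₁, u₂} (R : Type u₁) (M : Type u₂) [CommRing R] [AddCommGroup M]
    [Module R M] : Prop :=
  ∀ (L : Type w) [AddCommGroup L] [Module R L] (𝒰 : Set (Submodule R L)) (y : L ⊗[R] M),
    (∀ U ∈ 𝒰, U.mkQ.rTensor M y = 0) → (sInf 𝒰).mkQ.rTensor M y = 0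

/-- For intersection flat modules, finite generation of the ambient module is not needed. -/
theorem IsIntersectionFlat.tensorPreservesInter.{w} {R : Type u} {M : Type v} [CommRing R]
    [AddCommGroup M] [Module R M] (h : IsIntersectionFlat R M) :
    TensorPreservesInter.{w} R M := by
  intro L _ _ 𝒰 y hy
  have := h.1
  -- A tensor involves finitely many elements of `L`, so it comes from some `R ^ n`, which is
  -- finitely generated and lies in the universe of `R`. The submodules are pulled back there.
  obtain ⟨n, f, x, rfl⟩ : ∃ (n : ℕ) (f : (Fin n → R) →ₗ[R] L) (x : (Fin n → R) ⊗[R] M),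
      f.rTensor M x = y := by
    obtain ⟨n, l, m, rfl⟩ := TensorProduct.exists_sum_tmul_eq y
    exact ⟨n, Fintype.linearCombination R l, ∑ j, Pi.single j 1 ⊗ₜ m j, by
      simp [Fintype.linearCombination_apply_single]⟩
  refine rTensor_mkQ_eq_zero_of_le_comap (U := sInf (Submodule.comap f '' 𝒰)) f ?_ ?_
  · intro z hz
    simpa [Submodule.mem_sInf] using hz
  · rw [← mem_tensorImage_iff, h.2 _ inferInstance]
    simp only [Set.forall_mem_image, Submodule.mem_iInf]
    intro U hU
    rw [mem_tensorImage_iff, rTensor_mkQ_comap_eq_zero_iff]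
    exact hy U hU

theorem isIntersectionFlat_of_tensorPreservesInter {R : Type u} {M : Type v} [CommRing R]
    [AddCommGroup M] [Module R M] [Module.Flat R M] (h : TensorPreservesInter.{u} R M) :
    IsIntersectionFlat R M := by
  refine ⟨inferInstance, fun L _ _ _ 𝒰 ↦ le_antisymm ?_ fun y hy ↦ ?_⟩
  · refine le_iInf₂ fun U hU y hy ↦ ?_
    rw [mem_tensorImage_iff] at hy ⊢
    simpa using rTensor_mkQ_eq_zero_of_le_comap LinearMap.id (sInf_le hU) hy
  · rw [mem_tensorImage_iff]
    refine h L 𝒰 y fun U hU ↦ ?_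
    rw [← mem_tensorImage_iff]
    exact (Submodule.mem_iInf _).mp ((Submodule.mem_iInf _).mp hy U) hU

theorem rTensor_lTensor_apply {R L L' M N : Type*} [CommRing R] [AddCommGroup L] [Module R L]
    [AddCommGroup L'] [Module R L'] [AddCommGroup M] [Module R M] [AddCommGroup N] [Module R N]
    (f : L →ₗ[R] L') (g : M →ₗ[R] N) (y : L ⊗[R] M) :
    f.rTensor N (g.lTensor L y) = g.lTensor L' (f.rTensor M y) := by
  rw [← LinearMap.comp_apply, ← LinearMap.comp_apply, LinearMap.rTensor_comp_lTensor,
    LinearMap.lTensor_comp_rTensor]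

theorem TensorPreservesInter.of_retract.{w} {R M N : Type*} [CommRing R] [AddCommGroup M]
    [Module R M] [AddCommGroup N] [Module R N] (h : TensorPreservesInter.{w} R M)
    (i : N →ₗ[R] M) (r : M →ₗ[R] N) (hri : r ∘ₗ i = LinearMap.id) :
    TensorPreservesInter.{w} R N := by
  intro L _ _ 𝒰 y hy
  have := h L 𝒰 (i.lTensor L y) fun U hU ↦ by rw [rTensor_lTensor_apply, hy U hU, map_zero]
  rw [rTensor_lTensor_apply] at this
  have := congr_arg (r.lTensor _) this
  rwa [← LinearMap.comp_apply, ← LinearMap.lTensor_comp, hri, LinearMap.lTensor_id, map_zero,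
    LinearMap.id_apply] at this

theorem eq_zero_of_lTensor_lapply {R L M : Type*} [CommRing R] [AddCommGroup L] [Module R L]
    [AddCommGroup M] [Module R M] {ι : Type*} (y : L ⊗[R] (ι →₀ M))
    (hy : ∀ i, (Finsupp.lapply i : (ι →₀ M) →ₗ[R] M).lTensor L y = 0) : y = 0 := by
  classical
  apply (TensorProduct.finsuppRight R R L M ι).injective
  rw [map_zero]
  ext i
  rw [TensorProduct.finsuppRight_apply, hy i, Finsupp.zero_apply]

theorem TensorPreservesInter.finsupp.{w} {R M : Type*} [CommRing R] [AddCommGroup M]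
    [Module R M] (h : TensorPreservesInter.{w} R M) (ι : Type*) :
    TensorPreservesInter.{w} R (ι →₀ M) := by
  intro L _ _ 𝒰 y hy
  refine eq_zero_of_lTensor_lapply _ fun i ↦ ?_
  rw [← rTensor_lTensor_apply]
  exact h L 𝒰 _ fun U hU ↦ by rw [rTensor_lTensor_apply, hy U hU, map_zero]

/-- This rests on `L ⊗[S] (S ⊗[R] M) ≃ L ⊗[R] M`. A finite `S`-module need not be finite over `R`,
hence the need for arbitrary `L`. -/
theorem TensorPreservesInter.baseChange.{w} {R M : Type*} [CommRing R] [AddCommGroup M]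
    [Module R M] (h : TensorPreservesInter.{w} R M) (S : Type*) [CommRing S] [Algebra R S] :
    TensorPreservesInter.{w} S (S ⊗[R] M) := by
  intro L _ _ 𝒰 y hy
  let _ : Module R L := Module.compHom L (algebraMap R S)
  have : IsScalarTower R S L := IsScalarTower.of_compHom R S L
  let e (N : Type w) [AddCommGroup N] [Module R N] [Module S N] [IsScalarTower R S N] :=
    TensorProduct.AlgebraTensorModule.cancelBaseChange R S S N M
  have nat (N : Type w) [AddCommGroup N] [Module R N] [Module S N] [IsScalarTower R S N]
      (f : L →ₗ[S] N) (z : L ⊗[S] (S ⊗[R] M)) :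
      e N (f.rTensor _ z) = (f.restrictScalars R).rTensor M (e L z) := by
    induction z using TensorProduct.induction_on with
    | zero => simp
    | add a b ha hb => simp only [map_add, ha, hb]
    | tmul l t =>
      induction t using TensorProduct.induction_on with
      | zero => simp
      | add a b ha hb => simp only [TensorProduct.tmul_add, map_add, ha, hb]
      | tmul s m => simp [e]
  have key (U : Submodule S L) : U.mkQ.rTensor (S ⊗[R] M) y = 0 ↔
      (U.restrictScalars R).mkQ.rTensor M (e L y) = 0 := by
    rw [← (e (L ⧸ U)).map_eq_zero_iff, nat]
    let q := Submodule.Quotient.restrictScalarsEquiv R U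
    have hq : U.mkQ.restrictScalars R =
      (q.toLinearMap.restrictScalars R) ∘ₗ (U.restrictScalars R).mkQ := rfl
    rw [hq, LinearMap.rTensor_comp, LinearMap.comp_apply]
    exact ((q.restrictScalars R).rTensor M).map_eq_zero_iff
  rw [key]
  have hs : (sInf 𝒰).restrictScalars R = sInf (Submodule.restrictScalars R '' 𝒰) := by
    ext x
    simp [Submodule.mem_sInf]
  rw [hs]
  refine h L _ _ ?_
  rintro _ ⟨U, hU, rfl⟩
  exact (key U).mp (hy U hU)

end IntersectionFlat

theorem flat_finsupp {R M : Type*} [CommRing R] [AddCommGroup M] [Module R M] [Module.Flat R M]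
    (ι : Type*) : Module.Flat R (ι →₀ M) := by
  classical
  exact Module.Flat.of_linearEquiv (finsuppLequivDFinsupp R)

theorem projective_finsupp {R M : Type*} [CommRing R] [AddCommGroup M] [Module R M]
    [Module.Projective R M] (ι : Type*) : Module.Projective R (ι →₀ M) := by
  classical
  exact Module.Projective.of_equiv (finsuppLequivDFinsupp R).symm

/-! ### `F_* S` as a retract, by lifting to a polynomial ring -/

section FrobeniusRetract

variable {p : ℕ} [hp : Fact p.Prime] {R : Type u} {S : Type v} [CommRing R] [CommRing S]
  [Algebra (ZMod p) R] [Algebra R S] {σ : Type*}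

variable (p) in
/-- The identity map from `R` to `F_* R`. -/
def toFrobPush : R ≃+* FrobPush p R := RingEquiv.refl R

theorem smul_toFrobPush (r c : R) : r • toFrobPush p c = toFrobPush p (r ^ p * c) := rfl

theorem toFrobPush_symm_smul (r : R) (c : FrobPush p R) :
    (toFrobPush p).symm (r • c) = r ^ p * (toFrobPush p).symm c := rfl

variable (p R) in
/-- Given `x : σ → S`, the additive map sending the monomial `c X ^ m`, where `m = p • a + b` and
`b < p`, to `x ^ a ⊗ c` in the component of index `b`. -/
noncomputable def frobCoeff (x : σ → S) :
    MvPolynomial σ R →+ ((σ →₀ ℕ) →₀ S ⊗[R] FrobPush p R) :=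
  (Finsupp.liftAddHom fun m : σ →₀ ℕ ↦
    (Finsupp.singleAddHom (m.mapRange (· % p) (Nat.zero_mod p))).comp
      ((TensorProduct.mk R S (FrobPush p R)
        ((m.mapRange (· / p) (Nat.zero_div p)).prod fun i k ↦ x i ^ k)).toAddMonoidHom.comp
          (toFrobPush p).toAddMonoidHom)).comp
  (AddMonoidAlgebra.coeffAddEquiv (R := R) (M := σ →₀ ℕ)).toAddMonoidHom

theorem frobCoeff_monomial (x : σ → S) (m : σ →₀ ℕ) (c : R) :
    frobCoeff p R x (MvPolynomial.monomial m c) =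
      Finsupp.single (m.mapRange (· % p) (Nat.zero_mod p))
        (((m.mapRange (· / p) (Nat.zero_div p)).prod fun i k ↦ x i ^ k) ⊗ₜ toFrobPush p c) :=
  (Finsupp.liftAddHom_apply_single _ _ _).trans rfl

/-- `frobCoeff` is linear along the Frobenius. -/
theorem frobCoeff_pow_mul (x : σ → S) (t u : MvPolynomial σ R) :
    frobCoeff p R x (t ^ p * u) = MvPolynomial.aeval x t • frobCoeff p R x u := by
  induction t using MvPolynomial.induction_on' with
  | add t t' h h' => rw [add_pow_prime, add_mul, map_add, h, h', map_add, add_smul]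
  | monomial a r =>
    induction u using MvPolynomial.induction_on' with
    | add u u' h h' => rw [mul_add, map_add, h, h', map_add, smul_add]
    | monomial m c =>
      -- Adding `p • a` to an exponent keeps its remainder mod `p` and adds `a` to its quotient.
      have hmod : (p • a + m).mapRange (· % p) (Nat.zero_mod p) =
          m.mapRange (· % p) (Nat.zero_mod p) := by
        ext i
        simp
      have hdiv : (p • a + m).mapRange (· / p) (Nat.zero_div p) =
          a + m.mapRange (· / p) (Nat.zero_div p) := by
        ext i
        simp [Nat.mul_add_div hp.out.pos]
      rw [MvPolynomial.monomial_pow, MvPolynomial.monomial_mul, frobCoeff_monomial,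
        frobCoeff_monomial, hmod, hdiv, Finsupp.smul_single, ← smul_toFrobPush,
        ← TensorProduct.smul_tmul, TensorProduct.smul_tmul', MvPolynomial.aeval_monomial,
        Finsupp.prod_add_index' (fun _ ↦ pow_zero _) fun _ ↦ pow_add _, smul_eq_mul,
        Algebra.smul_def, mul_assoc]

variable [Algebra (ZMod p) S]

/-- Sending `s ⊗ c` in component `b` to `s ^ p * c * x ^ b` reassembles each monomial from quotient
and remainder, as `(x ^ a) ^ p * x ^ b = x ^ (p • a + b)`. -/
theorem exists_frobCoeff_retraction (x : σ → S) :
    ∃ r : ((σ →₀ ℕ) →₀ S ⊗[R] FrobPush p R) →ₗ[S] FrobPush p S,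
      ∀ t, r (frobCoeff p R x t) = toFrobPush p (MvPolynomial.aeval x t) := by
  let _ : Module R (FrobPush p S) := Module.compHom _ (algebraMap R S)
  have : IsScalarTower R S (FrobPush p S) := IsScalarTower.of_compHom R S (FrobPush p S)
  let f : FrobPush p R →ₗ[R] FrobPush p S :=
    { toFun c := toFrobPush p (algebraMap R S ((toFrobPush p).symm c))
      map_add' a b := by simp
      map_smul' r c := by
        rw [toFrobPush_symm_smul, map_mul, map_pow, ← smul_toFrobPush, algebraMap_smul,
          RingHom.id_apply] }
  refine ⟨Finsupp.lsum S fun b ↦ LinearMap.mulLeft S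
    (toFrobPush p (b.prod fun i k ↦ x i ^ k)) ∘ₗ f.liftBaseChange S, fun t ↦ ?_⟩
  induction t using MvPolynomial.induction_on' with
  | add t t' h h' => simp only [map_add, h, h']
  | monomial m c =>
    have hm : p • m.mapRange (· / p) (Nat.zero_div p) +
        m.mapRange (· % p) (Nat.zero_mod p) = m := by
      ext i
      simp [Nat.div_add_mod]
    have hf : f (toFrobPush p c) = toFrobPush p (algebraMap R S c) := rfl
    rw [frobCoeff_monomial, Finsupp.lsum_single, LinearMap.comp_apply,
      LinearMap.liftBaseChange_tmul, hf, smul_toFrobPush, LinearMap.mulLeft_apply, ← map_mul,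
      MvPolynomial.aeval_monomial]
    congr 1
    conv_rhs => rw [← hm, Finsupp.prod_add_index' (fun _ ↦ pow_zero _) fun _ ↦ pow_add _]
    have hpow (a : σ →₀ ℕ) :
        ((p • a).prod fun i k ↦ x i ^ k) = (a.prod fun i k ↦ x i ^ k) ^ p := by
      rw [Finsupp.prod, Finsupp.prod, Finsupp.support_smul_eq hp.out.ne_zero,
        ← Finset.prod_pow]
      exact Finset.prod_congr rfl fun i _ ↦ by
        rw [Finsupp.smul_apply, smul_eq_mul, mul_comm, pow_mul]
    rw [hpow]
    ring

theorem pow_mem_bracketPower {A : Type*} [CommRing A] {I : Ideal A} {a : A} (ha : a ∈ I)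
    (m : ℕ) : a ^ m ∈ bracketPower I m :=
  Ideal.subset_span ⟨a, ha, rfl⟩

theorem isBoundedNil_of_pow_eq_zero {A : Type*} [CommRing A] {I : Ideal A} {m : ℕ}
    (h : ∀ a ∈ I, a ^ m = 0) : IsBoundedNil I := by
  refine ⟨m, Ideal.span_eq_bot.mpr ?_⟩
  rintro _ ⟨a, ha, rfl⟩
  exact h a ha

/-- A b-nil formally smooth algebra maps to the polynomial ring `R[S]` modulo `J^{[m]}`,
where `J` is the kernel of `R[S] → S`, as a section of the projection to `S`. -/
theorem BNilFormallySmooth.exists_section (h : BNilFormallySmooth R S) (m : ℕ) (hm : m ≠ 0) :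
    ∃ f : S →ₐ[R] MvPolynomial S R ⧸
        bracketPower (RingHom.ker (MvPolynomial.aeval (R := R) (id : S → S))) m,
      ∀ s t, f s = Ideal.Quotient.mk _ t → MvPolynomial.aeval (id : S → S) t = s := by
  set q := MvPolynomial.aeval (R := R) (id : S → S)
  have hle : bracketPower (RingHom.ker q) m ≤ RingHom.ker q := by
    refine Ideal.span_le.mpr ?_
    rintro _ ⟨a, ha, rfl⟩
    exact Ideal.pow_mem_of_mem _ ha _ (Nat.pos_of_ne_zero hm)
  let π := Ideal.Quotient.liftₐ (bracketPower (RingHom.ker q) m) q fun a ha ↦ hle ha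
  have hπ : Function.Surjective π := fun s ↦
    ⟨Ideal.Quotient.mk _ (MvPolynomial.X s), MvPolynomial.aeval_X _ _⟩
  have hnil : IsBoundedNil (RingHom.ker π) := by
    refine isBoundedNil_of_pow_eq_zero (m := m) fun a ha ↦ ?_
    obtain ⟨t, rfl⟩ := Ideal.Quotient.mk_surjective a
    have ht : t ∈ RingHom.ker q := ha
    rw [← map_pow, Ideal.Quotient.eq_zero_iff_mem]
    exact pow_mem_bracketPower ht m
  let e := Ideal.quotientKerAlgEquivOfSurjective hπ
  -- Lifting the inverse of `(P / J^{[m]}) / ker π ≃ S` gives a section of `π`.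
  obtain ⟨f, hf⟩ := h _ (RingHom.ker π) hnil e.symm.toAlgHom
  refine ⟨f, fun s t hst ↦ ?_⟩
  have : e (Ideal.Quotient.mk _ (f s)) = s := by
    rw [← e.eq_symm_apply]
    exact DFunLike.congr_fun hf s
  rw [← this, hst]
  rfl

/-- For `R → S` b-nil formally smooth, `F_* S` is an `S`-linear retract of a direct sum of copies of
`S ⊗ F_* R`. -/
theorem BNilFormallySmooth.exists_frobPush_retract (h : BNilFormallySmooth R S) :
    ∃ (i : FrobPush p S →ₗ[S] ((S →₀ ℕ) →₀ S ⊗[R] FrobPush p R))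
      (r : ((S →₀ ℕ) →₀ S ⊗[R] FrobPush p R) →ₗ[S] FrobPush p S), r ∘ₗ i = LinearMap.id := by
  obtain ⟨f, hf⟩ := h.exists_section p hp.out.ne_zero
  obtain ⟨r, hr⟩ := exists_frobCoeff_retraction (p := p) (R := R) (id : S → S)
  let J := RingHom.ker (MvPolynomial.aeval (R := R) (id : S → S))
  -- A generator `b ^ p` of `J^{[p]}` acts on the target as the image of `b` in `S`, which is zero.
  have hJ (a : MvPolynomial S R) (ha : a ∈ bracketPower J p) (c : MvPolynomial S R) :
      frobCoeff p R id (c * a) = 0 := by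
    induction ha using Submodule.span_induction generalizing c with
    | zero => rw [mul_zero, map_zero]
    | add a b _ _ ha hb => rw [mul_add, map_add, ha, hb, add_zero]
    | smul b a _ ha => rw [smul_eq_mul, ← mul_assoc, ha]
    | mem a ha =>
      obtain ⟨b, hb, rfl⟩ := ha
      rw [mul_comm, frobCoeff_pow_mul, (RingHom.mem_ker).mp hb, zero_smul]
  let Ψ : (MvPolynomial S R ⧸ bracketPower J p) →+ ((S →₀ ℕ) →₀ S ⊗[R] FrobPush p R) :=
    QuotientAddGroup.lift _ (frobCoeff p R id)
      fun a ha ↦ by simpa using hJ a ha 1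
  have hΨ (t) : Ψ (Ideal.Quotient.mk _ t) = frobCoeff p R id t := rfl
  -- Any representative `t` of `f s` maps to `s`, so multiplication by `t ^ p` becomes the action of
  -- `s`.
  have hlin (s s' : S) : Ψ (f (s ^ p * s')) = s • Ψ (f s') := by
    obtain ⟨t, ht⟩ := Ideal.Quotient.mk_surjective (f s)
    obtain ⟨t', ht'⟩ := Ideal.Quotient.mk_surjective (f s')
    rw [map_mul, map_pow, ← ht, ← ht', ← map_pow, ← map_mul, hΨ, hΨ, frobCoeff_pow_mul,
      hf s t ht.symm]
  refine ⟨{ toFun s := Ψ (f ((toFrobPush p).symm s))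
            map_add' a b := by simp only [map_add]
            map_smul' s s' := by rw [toFrobPush_symm_smul, hlin, RingHom.id_apply] }, r, ?_⟩
  ext s
  obtain ⟨s, rfl⟩ := (toFrobPush p).surjective s
  obtain ⟨t, ht⟩ := Ideal.Quotient.mk_surjective (f s)
  simp only [LinearMap.comp_apply, LinearMap.coe_mk, AddHom.coe_mk, RingEquiv.symm_apply_apply,
    LinearMap.id_apply]
  rw [← ht, hΨ, hr, hf s t ht.symm]

end FrobeniusRetract

end BNil

theorem mainTheorem12 (p : ℕ) [Fact p.Prime] (R : Type u) (S : Type v) [CommRing R] [CommRing S]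
    [Algebra (ZMod p) R] [Algebra (ZMod p) S] [Algebra R S] (h : BNil.BNilFormallySmooth R S) :
    (BNil.IsFrobeniusOhmRushTrace p R → BNil.IsFrobeniusOhmRushTrace p S) ∧
    (BNil.IsFIntersectionFlat p R → BNil.IsFIntersectionFlat p S) ∧
    (Module.Projective R (BNil.FrobPush p R) →
      BNil.IsFrobeniusOhmRushTrace p S ∧ Module.Projective S (BNil.FrobPush p S)) := by
  obtain ⟨i, r, hri⟩ := h.exists_frobPush_retract (p := p)
  refine ⟨fun hR ↦ ?_, fun hR ↦ ?_, fun hR ↦ ?_⟩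
  · have hS := BNil.IsOhmRushTrace.baseChange (M := BNil.FrobPush p R) hR S
    exact (hS.finsupp _).of_retract i r (DFunLike.congr_fun hri)
  · have hfl : Module.Flat R (BNil.FrobPush p R) := hR.1
    have := BNil.flat_finsupp (R := S) (M := S ⊗[R] BNil.FrobPush p R) (S →₀ ℕ)
    have : Module.Flat S (BNil.FrobPush p S) := Module.Flat.of_retract i r hri
    have hS := (BNil.IsIntersectionFlat.tensorPreservesInter hR).baseChange S
    exact BNil.isIntersectionFlat_of_tensorPreservesInter ((hS.finsupp _).of_retract i r hri)
  · have := BNil.projective_finsupp (R := S) (M := S ⊗[R] BNil.FrobPush p R) (S →₀ ℕ)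
    have : Module.Projective S (BNil.FrobPush p S) := Module.Projective.of_split i r hri
    exact ⟨BNil.isOhmRushTrace_of_projective, this⟩
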